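/- **Theorem (Permutability theorem).** Let $\mathcal D\subset\mathbb R^2$ be open, $\varepsilon_0\in\{1,-1\}$, and equip $\mathbb K^3$ ($\mathbb K=\mathbb R$ or $\mathbb C$) with the bilinear product $u\cdot v=u_1v_1+\varepsilon_0(u_2v_2+u_3v_3)$. Let $A,B,C\in C^1(\mathcal D,\mathbb R)$ satisfy $AB-C^2=\epsilon$ with a constant $\epsilon\in\{1,-1\}$, and put $$L=\partial_x(A\partial_x+C\partial_y)+\partial_y(C\partial_x+B\partial_y).$$ A $C^2$ field $N:\mathcal D\to\mathbb K^3$ is called a *solution* if $$\text{(e1)}\quad LN=fN\ \text{ for some scalar function } f,\qquad\qquad \text{(e2)}\quad L(N\cdot N)=0 .$$ For a solution $N$ with $r=N\cdot N$ consider the system for a scalar function $p$ $$(\ast)\qquad \epsilon r_x+Cp_x+Bp_y=0,\qquad \epsilon r_y-Ap_x-Cp_y=0 ,$$ which determines $p$ up to an additive constant of integration. A *Bäcklund transform* of $N$ belonging to the solution $p$ of $(\ast)$ is a $C^2$ field $N'$ such that, for some nowhere vanishing $C^2$ scalar function $\theta$ with $L\theta=f\theta$ (the same $f$ as in (e1)),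 $$(\theta N')_x=\theta^2\left[C\left(\tfrac{N}{\theta}\right)_x+B\left(\tfrac{N}{\theta}\right)_y\right],\qquad (\theta N')_y=-\theta^2\left[A\left(\tfrac{N}{\theta}\right)_x+C\left(\tfrac{N}{\theta}\right)_y\right],$$ $$N\cdot N'=p,\qquad N'\cdot N'=-\epsilon\,N\cdot N .$$ Let $N$ be a solution with $N\cdot N\neq0$ on $\mathcal D$, let $P$ be a solution of $(\ast)$ for $N$, and let $N^{(1)},N^{(2)}$ be Bäcklund transforms of $N$ belonging to $P+k_1$ and $P+k_2$, where $k_1,k_2\in\mathbb K$ are constants. Assume that $(N^{(1)}-N^{(2)})\cdot(N^{(1)}-N^{(2)})\ne0$ on $\mathcal D$. Since $N^{(i)}\cdot N^{(i)}=-\epsilon\,N\cdot N$, the system $(\ast)$ for $N^{(i)}$ is solved by the functions $-\epsilon(P+k)$, $k$ constant. Then there are Bäcklund transforms $N^{(12)}$ of $N^{(1)}$, belonging to $-\epsilon(P+k_2)$, and $N^{(21)}$ of $N^{(2)}$, belonging to $-\epsilon(P+k_1)$ (with the same $A,B,C$), which are solutions of (e1)-(e2), such that on $\mathcal D$ $$N^{(12)}=N^{(21)}=\epsilon\left[-N+\frac{2\,(N^{(1)}-N^{(2)})\cdot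 N}{(N^{(1)}-N^{(2)})\cdot(N^{(1)}-N^{(2)})}\,(N^{(1)}-N^{(2)})\right].$$ -/

import Mathlib

noncomputable section

namespace Bianchi

/-- Partial derivative in the first variable `x`. -/
def dx {E : Type*} [NormedAddCommGroup E] [NormedSpace ℝ E] (u : ℝ × ℝ → E) (z : ℝ × ℝ) : E :=
  fderiv ℝ u z (1, 0)

/-- Partial derivative in the second variable `y`. -/
def dy {E : Type*} [NormedAddCommGroup E] [NormedSpace ℝ E] (u : ℝ × ℝ → E) (z : ℝ × ℝ) : E :=
  fderiv ℝ u z (0, 1)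

/-- The self-adjoint operator `∂x (A ∂x + C ∂y) + ∂y (C ∂x + B ∂y)`. -/
def selfAdjointOp {E : Type*} [NormedAddCommGroup E] [NormedSpace ℝ E] (A B C : ℝ × ℝ → ℝ)
    (u : ℝ × ℝ → E) (z : ℝ × ℝ) : E :=
  dx (fun w => A w • dx u w + C w • dy u w) z + dy (fun w => C w • dx u w + B w • dy u w) z

/-- The bilinear scalar product `u₁ v₁ + η (u₂ v₂ + u₃ v₃)`: Euclidean for `η = 1`, Minkowski for
`η = -1`. For complex vectors it is the complex bilinear extension (no conjugation). -/
def dot {𝕜 : Type*} [RCLike 𝕜] (η : ℝ) (u v : Fin 3 → 𝕜) : 𝕜 :=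
  u 0 * v 0 + (η : 𝕜) * (u 1 * v 1 + u 2 * v 2)

/-- `N` is a `C²` solution on `D`, with scalar function `f`, of the normal field equations of Bianchi
surfaces: `L N = f N` and `L (N · N) = 0`, where `L = ∂x (A ∂x + C ∂y) + ∂y (C ∂x + B ∂y)`. -/
structure IsSolution {𝕜 : Type*} [RCLike 𝕜] (η : ℝ) (A B C : ℝ × ℝ → ℝ) (D : Set (ℝ × ℝ))
    (f : ℝ × ℝ → 𝕜) (N : ℝ × ℝ → Fin 3 → 𝕜) : Prop where
  contDiffOn : ContDiffOn ℝ 2 N D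
  normal_eq : ∀ z ∈ D, selfAdjointOp A B C N z = f z • N z
  norm_eq : ∀ z ∈ D, selfAdjointOp A B C (fun w => dot η (N w) (N w)) z = 0

/-- `p` solves the first-order system
`ε r_x + C p_x + B p_y = 0`, `ε r_y - A p_x - C p_y = 0` on `D`, with `r = N · N`.
On a connected `D` its solutions differ by an additive constant, the spectral parameter. -/
structure IsPotential {𝕜 : Type*} [RCLike 𝕜] (η ε : ℝ) (A B C : ℝ × ℝ → ℝ) (D : Set (ℝ × ℝ))
    (N : ℝ × ℝ → Fin 3 → 𝕜) (p : ℝ × ℝ → 𝕜) : Prop where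
  differentiableOn : DifferentiableOn ℝ p D
  eq_x : ∀ z ∈ D, ε • dx (fun w => dot η (N w) (N w)) z + C z • dx p z + B z • dy p z = 0
  eq_y : ∀ z ∈ D, ε • dy (fun w => dot η (N w) (N w)) z - A z • dx p z - C z • dy p z = 0

/-- `N'` is the extended Moutard transform of `N` on `D` generated by the nowhere vanishing scalar
solution `θ` of the same equation `L θ = f θ` that `N` satisfies:
`(θ N')_x = θ² (C (N/θ)_x + B (N/θ)_y)`, `(θ N')_y = -θ² (A (N/θ)_x + C (N/θ)_y)`. -/
structure IsMoutard {𝕜 : Type*} [RCLike 𝕜] (A B C : ℝ × ℝ → ℝ) (D : Set (ℝ × ℝ))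
    (f θ : ℝ × ℝ → 𝕜) (N N' : ℝ × ℝ → Fin 3 → 𝕜) : Prop where
  theta_contDiffOn : ContDiffOn ℝ 2 θ D
  theta_ne_zero : ∀ z ∈ D, θ z ≠ 0
  theta_eq : ∀ z ∈ D, selfAdjointOp A B C θ z = f z * θ z
  contDiffOn : ContDiffOn ℝ 2 N' D
  eq_x : ∀ z ∈ D, dx (fun w => θ w • N' w) z =
    θ z ^ 2 • (C z • dx (fun w => (θ w)⁻¹ • N w) z + B z • dy (fun w => (θ w)⁻¹ • N w) z)
  eq_y : ∀ z ∈ D, dy (fun w => θ w • N' w) z =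
    -(θ z ^ 2 • (A z • dx (fun w => (θ w)⁻¹ • N w) z + C z • dy (fun w => (θ w)⁻¹ • N w) z))

/-- `N'` is a Bäcklund transform on `D` of the solution `N`, for coefficients with
`A B - C² = ε`, belonging to the solution `p` of the first-order system of `N`: it is an extended
Moutard transform of `N` with `N · N' = p`, subject to the constraint `N' · N' = -ε (N · N)`.

In an orthonormal frame `n₀ = N/√r, n₁, n₂`, writing `θ N' = ∑ x^A n_A`, the Moutard equations
(with `θ = x⁰ √r / p`) are the linear system for `x⁰, x¹, x²`, and the last condition is the
quadratic constraint on its solutions. -/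
def IsBacklund {𝕜 : Type*} [RCLike 𝕜] (η ε : ℝ) (A B C : ℝ × ℝ → ℝ) (D : Set (ℝ × ℝ))
    (N : ℝ × ℝ → Fin 3 → 𝕜) (p : ℝ × ℝ → 𝕜) (N' : ℝ × ℝ → Fin 3 → 𝕜) : Prop :=
  IsPotential η ε A B C D N p ∧
  (∃ f θ : ℝ × ℝ → 𝕜, IsSolution η A B C D f N ∧ IsMoutard A B C D f θ N N') ∧
  (∀ z ∈ D, dot η (N z) (N' z) = p z) ∧
  (∀ z ∈ D, dot η (N' z) (N' z) = -(ε • dot η (N z) (N z)))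

end Bianchi

end

/-!
Write `⋆` for the linear operation on one-forms with
`⋆du = (C uₓ + B u_y) dx - (A uₓ + C u_y) dy`. Then `d(⋆du) = -(L u) dx ∧ dy`, and `A B - C² = ε`
gives `⋆⋆ = -ε`. In this language the first-order system for the potential is `dp = ⋆dr` with
`r = N · N`, and the Moutard equations are `d(θ N') = θ ⋆dN - N ⋆dθ`, a relation between scalar
functions for every component (`MoutardOn`).

Two formal properties of this relation carry the linear part. It can be inverted
(`MoutardOn.inverse`): if `N'` is the transform of `N` generated by `θ`, then `-ε N` is the
transform of `N'` generated by `θ⁻¹`. And its right-hand side is closed, so that `N` and `θ` satisfy the same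
linear equation (`MoutardOn.mul_selfAdjointOp`). Together they show that a transform `N'` solves
`L N' = f' N'` with `f' = θ L(θ⁻¹)`, the equation of `θ⁻¹`; with the constraint
`N' · N' = -ε N · N` it is again a solution (`isSolution_of_moutardOn`).

For the superposition let `θ₁`, `θ₂` generate `N₁`, `N₂`. By Moutard's classical construction a
generator of a transform of `N₁` is `S / θ₁`, where `dS = θ₁ ⋆dθ₂ - θ₂ ⋆dθ₁`. In general `S` takes a
quadrature, but here the quadratic constraints provide it (`moutardOn_dot_sub`): with
`W = (N₁ - N₂) · (N₁ - N₂)`,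
`d(θ₁ θ₂ W) = 2 (k₁ - k₂) (θ₁ ⋆dθ₂ - θ₂ ⋆dθ₁)`.
For `k₁ ≠ k₂` the generator is therefore `θ₂ W`, and the linear superposition formula
(`MoutardOn.superposition`) becomes the permutability formula because `(N₁ - N₂) · N = k₁ - k₂`. For
`k₁ = k₂` the formula reads `-ε N`, which is the inverse transform. The algebraic conditions hold
because the formula is a reflection of `N`, up to sign, and it is symmetric in `N₁` and `N₂`, so
both ways around the quadrilateral end at the same vertex.
-/

noncomputable section
namespace Bianchi
open Filter Topology

/-! ### Calculus of partial derivatives -/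

section Derivatives
variable {𝕜 : Type*} [RCLike 𝕜] {E : Type*} [NormedAddCommGroup E] [NormedSpace ℝ E]

theorem dx_congr {D : Set (ℝ × ℝ)} (hD : IsOpen D) {u v : ℝ × ℝ → E} (h : ∀ z ∈ D, u z = v z)
    {z : ℝ × ℝ} (hz : z ∈ D) : dx u z = dx v z := by
  have : u =ᶠ[𝓝 z] v := Filter.eventually_of_mem (hD.mem_nhds hz) h
  rw [dx, dx, this.fderiv_eq]

theorem dy_congr {D : Set (ℝ × ℝ)} (hD : IsOpen D) {u v : ℝ × ℝ → E} (h : ∀ z ∈ D, u z = v z)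
    {z : ℝ × ℝ} (hz : z ∈ D) : dy u z = dy v z := by
  have : u =ᶠ[𝓝 z] v := Filter.eventually_of_mem (hD.mem_nhds hz) h
  rw [dy, dy, this.fderiv_eq]

theorem selfAdjointOp_congr {D : Set (ℝ × ℝ)} (hD : IsOpen D) {A B C : ℝ × ℝ → ℝ}
    {u v : ℝ × ℝ → E} (h : ∀ z ∈ D, u z = v z) {z : ℝ × ℝ} (hz : z ∈ D) :
    selfAdjointOp A B C u z = selfAdjointOp A B C v z := by
  unfold selfAdjointOp
  congr 1
  · exact dx_congr hD (fun w hw => by rw [dx_congr hD h hw, dy_congr hD h hw]) hz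
  · exact dy_congr hD (fun w hw => by rw [dx_congr hD h hw, dy_congr hD h hw]) hz

theorem dx_add {u v : ℝ × ℝ → E} {z : ℝ × ℝ} (hu : DifferentiableAt ℝ u z)
    (hv : DifferentiableAt ℝ v z) : dx (fun w => u w + v w) z = dx u z + dx v z := by
  simp [dx, fderiv_fun_add hu hv]

theorem dy_add {u v : ℝ × ℝ → E} {z : ℝ × ℝ} (hu : DifferentiableAt ℝ u z)
    (hv : DifferentiableAt ℝ v z) : dy (fun w => u w + v w) z = dy u z + dy v z := by
  simp [dy, fderiv_fun_add hu hv]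

theorem dx_sub {u v : ℝ × ℝ → E} {z : ℝ × ℝ} (hu : DifferentiableAt ℝ u z)
    (hv : DifferentiableAt ℝ v z) : dx (fun w => u w - v w) z = dx u z - dx v z := by
  simp [dx, fderiv_fun_sub hu hv]

theorem dy_sub {u v : ℝ × ℝ → E} {z : ℝ × ℝ} (hu : DifferentiableAt ℝ u z)
    (hv : DifferentiableAt ℝ v z) : dy (fun w => u w - v w) z = dy u z - dy v z := by
  simp [dy, fderiv_fun_sub hu hv]

theorem dx_mul {u v : ℝ × ℝ → 𝕜} {z : ℝ × ℝ} (hu : DifferentiableAt ℝ u z)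
    (hv : DifferentiableAt ℝ v z) :
    dx (fun w => u w * v w) z = u z * dx v z + v z * dx u z := by
  simp [dx, fderiv_fun_mul hu hv]

theorem dy_mul {u v : ℝ × ℝ → 𝕜} {z : ℝ × ℝ} (hu : DifferentiableAt ℝ u z)
    (hv : DifferentiableAt ℝ v z) :
    dy (fun w => u w * v w) z = u z * dy v z + v z * dy u z := by
  simp [dy, fderiv_fun_mul hu hv]

theorem dx_const_mul (c : 𝕜) {u : ℝ × ℝ → 𝕜} {z : ℝ × ℝ} (hu : DifferentiableAt ℝ u z) :
    dx (fun w => c * u w) z = c * dx u z := by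
  simp [dx, fderiv_const_mul hu]

theorem dy_const_mul (c : 𝕜) {u : ℝ × ℝ → 𝕜} {z : ℝ × ℝ} (hu : DifferentiableAt ℝ u z) :
    dy (fun w => c * u w) z = c * dy u z := by
  simp [dy, fderiv_const_mul hu]

theorem dx_inv {u : ℝ × ℝ → 𝕜} {z : ℝ × ℝ} (hu : DifferentiableAt ℝ u z) (h0 : u z ≠ 0) :
    dx (fun w => (u w)⁻¹) z = -dx u z / u z ^ 2 := by
  have h := ((hasStrictFDerivAt_inv' (𝕜 := ℝ) h0).hasFDerivAt.comp z hu.hasFDerivAt).fderiv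
  simp only [Function.comp_def] at h
  rw [dx, h]
  simp [dx]
  field_simp

theorem dy_inv {u : ℝ × ℝ → 𝕜} {z : ℝ × ℝ} (hu : DifferentiableAt ℝ u z) (h0 : u z ≠ 0) :
    dy (fun w => (u w)⁻¹) z = -dy u z / u z ^ 2 := by
  have h := ((hasStrictFDerivAt_inv' (𝕜 := ℝ) h0).hasFDerivAt.comp z hu.hasFDerivAt).fderiv
  simp only [Function.comp_def] at h
  rw [dy, h]
  simp [dy]
  field_simp

theorem dx_apply {ι : Type*} [Fintype ι] {u : ℝ × ℝ → ι → 𝕜} {z : ℝ × ℝ}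
    (hu : DifferentiableAt ℝ u z) (i : ι) : dx u z i = dx (fun w => u w i) z := by
  rw [dx, dx, fderiv_apply hu i]; rfl

theorem dy_apply {ι : Type*} [Fintype ι] {u : ℝ × ℝ → ι → 𝕜} {z : ℝ × ℝ}
    (hu : DifferentiableAt ℝ u z) (i : ι) : dy u z i = dy (fun w => u w i) z := by
  rw [dy, dy, fderiv_apply hu i]; rfl

/-- Mixed second partial derivatives of a `C²` function commute. -/
theorem dy_dx_comm {D : Set (ℝ × ℝ)} (hD : IsOpen D) {u : ℝ × ℝ → E} (hu : ContDiffOn ℝ 2 u D)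
    {z : ℝ × ℝ} (hz : z ∈ D) : dy (dx u) z = dx (dy u) z := by
  have hc : ContDiffAt ℝ 2 u z := hu.contDiffAt (hD.mem_nhds hz)
  have hd : DifferentiableAt ℝ (fderiv ℝ u) z :=
    (hc.fderiv_right (m := 1) (by norm_num)).differentiableAt (by norm_num)
  have hs : IsSymmSndFDerivAt ℝ u z := hc.isSymmSndFDerivAt (by simp)
  have e (a : ℝ × ℝ) : fderiv ℝ (fun w => fderiv ℝ u w a) z = (fderiv ℝ (fderiv ℝ u) z).flip a := by
    rw [fderiv_clm_apply hd (differentiableAt_const _)]; simp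
  change fderiv ℝ (fun w => fderiv ℝ u w (1, 0)) z (0, 1) =
    fderiv ℝ (fun w => fderiv ℝ u w (0, 1)) z (1, 0)
  rw [e, e]
  exact hs.eq _ _

theorem differentiableAt_of_contDiffOn {D : Set (ℝ × ℝ)} (hD : IsOpen D) {n : WithTop ℕ∞}
    {u : ℝ × ℝ → E} (hu : ContDiffOn ℝ n u D) (hn : n ≠ 0) {z : ℝ × ℝ} (hz : z ∈ D) :
    DifferentiableAt ℝ u z :=
  (hu.contDiffAt (hD.mem_nhds hz)).differentiableAt hn

theorem contDiffOn_dx {D : Set (ℝ × ℝ)} (hD : IsOpen D) {u : ℝ × ℝ → E}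
    (hu : ContDiffOn ℝ 2 u D) : ContDiffOn ℝ 1 (dx u) D :=
  (hu.fderiv_of_isOpen hD (m := 1) (by norm_num)).clm_apply contDiffOn_const

theorem contDiffOn_dy {D : Set (ℝ × ℝ)} (hD : IsOpen D) {u : ℝ × ℝ → E}
    (hu : ContDiffOn ℝ 2 u D) : ContDiffOn ℝ 1 (dy u) D :=
  (hu.fderiv_of_isOpen hD (m := 1) (by norm_num)).clm_apply contDiffOn_const

end Derivatives

variable {𝕜 : Type*} [RCLike 𝕜] {A B C : ℝ × ℝ → ℝ} {D : Set (ℝ × ℝ)} {η ε : ℝ}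

/-! ### The star operator and scalar Moutard relations -/

/-- The `dx`-coefficient `C uₓ + B u_y` of the one-form `⋆du`. -/
def starX (B C : ℝ × ℝ → ℝ) (u : ℝ × ℝ → 𝕜) (z : ℝ × ℝ) : 𝕜 :=
  (C z : 𝕜) * dx u z + (B z : 𝕜) * dy u z

/-- The `dy`-coefficient `-(A uₓ + C u_y)` of the one-form `⋆du`. -/
def starY (A C : ℝ × ℝ → ℝ) (u : ℝ × ℝ → 𝕜) (z : ℝ × ℝ) : 𝕜 :=
  -((A z : 𝕜) * dx u z + (C z : 𝕜) * dy u z)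

/-- The scalar Moutard relation `d(θ v) = θ ⋆du - u ⋆dθ = θ² ⋆d(u/θ)` on `D`. -/
structure MoutardOn (A B C : ℝ × ℝ → ℝ) (D : Set (ℝ × ℝ)) (θ u v : ℝ × ℝ → 𝕜) : Prop where
  eq_x : ∀ z ∈ D, dx (fun w => θ w * v w) z = θ z * starX B C u z - u z * starX B C θ z
  eq_y : ∀ z ∈ D, dy (fun w => θ w * v w) z = θ z * starY A C u z - u z * starY A C θ z

theorem contDiffOn_ofReal {n : WithTop ℕ∞} {a : ℝ × ℝ → ℝ} (ha : ContDiffOn ℝ n a D) :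
    ContDiffOn ℝ n (fun z => (a z : 𝕜)) D :=
  (RCLike.ofRealCLM (K := 𝕜)).contDiff.comp_contDiffOn ha

theorem contDiffOn_starX (hD : IsOpen D) (hB : ContDiffOn ℝ 1 B D) (hC : ContDiffOn ℝ 1 C D)
    {u : ℝ × ℝ → 𝕜} (hu : ContDiffOn ℝ 2 u D) : ContDiffOn ℝ 1 (starX B C u) D :=
  ((contDiffOn_ofReal hC).mul (contDiffOn_dx hD hu)).add
    ((contDiffOn_ofReal hB).mul (contDiffOn_dy hD hu))

theorem contDiffOn_starY (hD : IsOpen D) (hA : ContDiffOn ℝ 1 A D) (hC : ContDiffOn ℝ 1 C D)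
    {u : ℝ × ℝ → 𝕜} (hu : ContDiffOn ℝ 2 u D) : ContDiffOn ℝ 1 (starY A C u) D :=
  (((contDiffOn_ofReal hA).mul (contDiffOn_dx hD hu)).add
    ((contDiffOn_ofReal hC).mul (contDiffOn_dy hD hu))).neg

/-- In terms of forms, `d(⋆du) = -(L u) dx ∧ dy`. -/
theorem selfAdjointOp_eq_star (u : ℝ × ℝ → 𝕜) (z : ℝ × ℝ) :
    selfAdjointOp A B C u z = dy (starX B C u) z - dx (starY A C u) z := by
  have e1 : starY A C u = -(fun w => A w • dx u w + C w • dy u w) := by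
    funext w; simp [starY, RCLike.real_smul_eq_coe_mul]
  have e2 : starX B C u = fun w => C w • dx u w + B w • dy u w := by
    funext w; simp [starX, RCLike.real_smul_eq_coe_mul]
  have e3 : dx (-(fun w => A w • dx u w + C w • dy u w)) z =
      -dx (fun w => A w • dx u w + C w • dy u w) z := by
    rw [dx, dx, fderiv_neg]; rfl
  rw [e1, e2, e3, selfAdjointOp]
  ring

theorem selfAdjointOp_apply (hD : IsOpen D) (hA : ContDiffOn ℝ 1 A D) (hB : ContDiffOn ℝ 1 B D)
    (hC : ContDiffOn ℝ 1 C D) {u : ℝ × ℝ → Fin 3 → 𝕜} (hu : ContDiffOn ℝ 2 u D)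
    {z : ℝ × ℝ} (hz : z ∈ D) (i : Fin 3) :
    selfAdjointOp A B C u z i = selfAdjointOp A B C (fun w => u w i) z := by
  have hux := contDiffOn_dx hD hu
  have huy := contDiffOn_dy hD hu
  have hd : ∀ w ∈ D, DifferentiableAt ℝ u w := fun w hw =>
    differentiableAt_of_contDiffOn hD hu (by norm_num) hw
  unfold selfAdjointOp
  have h1 : DifferentiableAt ℝ (fun w => A w • dx u w + C w • dy u w) z :=
    differentiableAt_of_contDiffOn hD ((hA.smul hux).add (hC.smul huy)) (by norm_num) hz
  have h2 : DifferentiableAt ℝ (fun w => C w • dx u w + B w • dy u w) z :=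
    differentiableAt_of_contDiffOn hD ((hC.smul hux).add (hB.smul huy)) (by norm_num) hz
  rw [Pi.add_apply, dx_apply h1, dy_apply h2]
  congr 1
  · refine dx_congr hD (fun w hw => ?_) hz
    rw [Pi.add_apply, Pi.smul_apply, Pi.smul_apply, dx_apply (hd w hw), dy_apply (hd w hw)]
  · refine dy_congr hD (fun w hw => ?_) hz
    rw [Pi.add_apply, Pi.smul_apply, Pi.smul_apply, dx_apply (hd w hw), dy_apply (hd w hw)]

theorem selfAdjointOp_const_mul (hD : IsOpen D) (hA : ContDiffOn ℝ 1 A D)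
    (hB : ContDiffOn ℝ 1 B D) (hC : ContDiffOn ℝ 1 C D) (c : 𝕜) {u : ℝ × ℝ → 𝕜}
    (hu : ContDiffOn ℝ 2 u D) {z : ℝ × ℝ} (hz : z ∈ D) :
    selfAdjointOp A B C (fun w => c * u w) z = c * selfAdjointOp A B C u z := by
  have hd : ∀ w ∈ D, DifferentiableAt ℝ u w := fun w hw =>
    differentiableAt_of_contDiffOn hD hu (by norm_num) hw
  rw [selfAdjointOp_eq_star, selfAdjointOp_eq_star, mul_sub,
    ← dy_const_mul c (differentiableAt_of_contDiffOn hD (contDiffOn_starX hD hB hC hu)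
      (by norm_num) hz),
    ← dx_const_mul c (differentiableAt_of_contDiffOn hD (contDiffOn_starY hD hA hC hu)
      (by norm_num) hz)]
  congr 1
  · refine dy_congr hD (fun w hw => ?_) hz
    rw [starX, starX, dx_const_mul c (hd w hw), dy_const_mul c (hd w hw)]
    ring
  · refine dx_congr hD (fun w hw => ?_) hz
    rw [starY, starY, dx_const_mul c (hd w hw), dy_const_mul c (hd w hw)]
    ring

/-- The form `θ ⋆du - u ⋆dθ` has exterior derivative `(u Lθ - θ Lu) dx ∧ dy`, because
`dθ ∧ ⋆du` is symmetric in `θ` and `u`; it is exact by assumption, hence closed. -/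
theorem MoutardOn.mul_selfAdjointOp (hD : IsOpen D) (hA : ContDiffOn ℝ 1 A D)
    (hB : ContDiffOn ℝ 1 B D) (hC : ContDiffOn ℝ 1 C D) {θ u v : ℝ × ℝ → 𝕜}
    (hθ : ContDiffOn ℝ 2 θ D) (hu : ContDiffOn ℝ 2 u D) (hv : ContDiffOn ℝ 2 v D)
    (h : MoutardOn A B C D θ u v) {z : ℝ × ℝ} (hz : z ∈ D) :
    θ z * selfAdjointOp A B C u z = u z * selfAdjointOp A B C θ z := by
  have hθd := differentiableAt_of_contDiffOn hD hθ (by norm_num) hz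
  have hud := differentiableAt_of_contDiffOn hD hu (by norm_num) hz
  have hXu := differentiableAt_of_contDiffOn hD (contDiffOn_starX hD hB hC hu) (by norm_num) hz
  have hXθ := differentiableAt_of_contDiffOn hD (contDiffOn_starX hD hB hC hθ) (by norm_num) hz
  have hYu := differentiableAt_of_contDiffOn hD (contDiffOn_starY hD hA hC hu) (by norm_num) hz
  have hYθ := differentiableAt_of_contDiffOn hD (contDiffOn_starY hD hA hC hθ) (by norm_num) hz
  have hs := dy_dx_comm hD (hθ.mul hv) hz
  rw [dy_congr hD h.eq_x hz, dx_congr hD h.eq_y hz,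
    dy_sub (hθd.fun_mul hXu) (hud.fun_mul hXθ), dx_sub (hθd.fun_mul hYu) (hud.fun_mul hYθ),
    dy_mul hθd hXu, dy_mul hud hXθ, dx_mul hθd hYu, dx_mul hud hYθ] at hs
  rw [selfAdjointOp_eq_star, selfAdjointOp_eq_star]
  have e1 : starX B C u z = (C z : 𝕜) * dx u z + (B z : 𝕜) * dy u z := rfl
  have e2 : starX B C θ z = (C z : 𝕜) * dx θ z + (B z : 𝕜) * dy θ z := rfl
  have e3 : starY A C u z = -((A z : 𝕜) * dx u z + (C z : 𝕜) * dy u z) := rfl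
  have e4 : starY A C θ z = -((A z : 𝕜) * dx θ z + (C z : 𝕜) * dy θ z) := rfl
  rw [e1, e2, e3, e4] at hs
  linear_combination hs

/-- Since `⋆⋆ = -ε`, applying `⋆` to the Moutard relation inverts it. -/
theorem MoutardOn.inverse (hABC : ∀ z ∈ D, A z * B z - C z ^ 2 = ε)
    {θ u v : ℝ × ℝ → 𝕜} (hθ : ∀ z ∈ D, DifferentiableAt ℝ θ z)
    (hu : ∀ z ∈ D, DifferentiableAt ℝ u z) (hv : ∀ z ∈ D, DifferentiableAt ℝ v z)
    (h0 : ∀ z ∈ D, θ z ≠ 0) (h : MoutardOn A B C D θ u v) :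
    MoutardOn A B C D (fun z => (θ z)⁻¹) v (fun z => -((ε : 𝕜) * u z)) := by
  have hinv : ∀ z ∈ D, DifferentiableAt ℝ (fun w => (θ w)⁻¹) z := fun z hz =>
    (hθ z hz).fun_inv (h0 z hz)
  have hm : (fun w => (θ w)⁻¹ * -((ε : 𝕜) * u w)) = fun w => (-(ε : 𝕜)) * ((θ w)⁻¹ * u w) := by
    funext w; ring
  have hK : ∀ z ∈ D, (A z : 𝕜) * B z - (C z : 𝕜) ^ 2 = ε := fun z hz => by
    exact_mod_cast congrArg (fun t : ℝ => (t : 𝕜)) (hABC z hz)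
  constructor <;> intro z hz
  · have h1 := h.eq_x z hz
    have h2 := h.eq_y z hz
    have hk := hK z hz
    have := h0 z hz
    rw [dx_mul (hθ z hz) (hv z hz)] at h1
    rw [dy_mul (hθ z hz) (hv z hz)] at h2
    simp only [starX, starY] at h1 h2 ⊢
    rw [hm, dx_const_mul _ ((hinv z hz).fun_mul (hu z hz)), dx_mul (hinv z hz) (hu z hz),
      dx_inv (hθ z hz) this, dy_inv (hθ z hz) this]
    field_simp
    linear_combination (u z * dx θ z - θ z * dx u z) * (-hk) - (C z : 𝕜) * h1 - (B z : 𝕜) * h2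
  · have h1 := h.eq_x z hz
    have h2 := h.eq_y z hz
    have hk := hK z hz
    have := h0 z hz
    rw [dx_mul (hθ z hz) (hv z hz)] at h1
    rw [dy_mul (hθ z hz) (hv z hz)] at h2
    simp only [starX, starY] at h1 h2 ⊢
    rw [hm, dy_const_mul _ ((hinv z hz).fun_mul (hu z hz)), dy_mul (hinv z hz) (hu z hz),
      dx_inv (hθ z hz) this, dy_inv (hθ z hz) this]
    field_simp
    linear_combination (u z * dy θ z - θ z * dy u z) * (-hk) + (A z : 𝕜) * h1 + (C z : 𝕜) * h2

/-! ### Moutard transforms of vector fields -/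

theorem dx_dot {u v : ℝ × ℝ → Fin 3 → 𝕜} {z : ℝ × ℝ} (hu : DifferentiableAt ℝ u z)
    (hv : DifferentiableAt ℝ v z) :
    dx (fun w => dot η (u w) (v w)) z = dot η (dx u z) (v z) + dot η (u z) (dx v z) := by
  have hu' := differentiableAt_pi.1 hu
  have hv' := differentiableAt_pi.1 hv
  have hm (i : Fin 3) : DifferentiableAt ℝ (fun w => u w i * v w i) z := (hu' i).fun_mul (hv' i)
  unfold dot
  rw [dx_add (hm 0) (((hm 1).fun_add (hm 2)).const_mul _), dx_const_mul _ ((hm 1).fun_add (hm 2)),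
    dx_add (hm 1) (hm 2), dx_mul (hu' 0) (hv' 0), dx_mul (hu' 1) (hv' 1), dx_mul (hu' 2) (hv' 2)]
  simp only [dx_apply hu, dx_apply hv]
  ring

theorem dy_dot {u v : ℝ × ℝ → Fin 3 → 𝕜} {z : ℝ × ℝ} (hu : DifferentiableAt ℝ u z)
    (hv : DifferentiableAt ℝ v z) :
    dy (fun w => dot η (u w) (v w)) z = dot η (dy u z) (v z) + dot η (u z) (dy v z) := by
  have hu' := differentiableAt_pi.1 hu
  have hv' := differentiableAt_pi.1 hv
  have hm (i : Fin 3) : DifferentiableAt ℝ (fun w => u w i * v w i) z := (hu' i).fun_mul (hv' i)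
  unfold dot
  rw [dy_add (hm 0) (((hm 1).fun_add (hm 2)).const_mul _), dy_const_mul _ ((hm 1).fun_add (hm 2)),
    dy_add (hm 1) (hm 2), dy_mul (hu' 0) (hv' 0), dy_mul (hu' 1) (hv' 1), dy_mul (hu' 2) (hv' 2)]
  simp only [dy_apply hu, dy_apply hv]
  ring

theorem contDiffOn_dot {n : WithTop ℕ∞} {u v : ℝ × ℝ → Fin 3 → 𝕜} (hu : ContDiffOn ℝ n u D)
    (hv : ContDiffOn ℝ n v D) : ContDiffOn ℝ n (fun w => dot η (u w) (v w)) D := by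
  have hu' := contDiffOn_pi.1 hu
  have hv' := contDiffOn_pi.1 hv
  exact ((hu' 0).mul (hv' 0)).add
    (contDiffOn_const.mul (((hu' 1).mul (hv' 1)).add ((hu' 2).mul (hv' 2))))

/-- The quotient form `θ² ⋆d(u/θ)` of a Moutard relation agrees with `θ ⋆du - u ⋆dθ`. -/
theorem moutard_quotient {θ u : ℝ × ℝ → 𝕜} {z : ℝ × ℝ} (hθ : DifferentiableAt ℝ θ z)
    (hu : DifferentiableAt ℝ u z) (h0 : θ z ≠ 0) (a b : ℝ) :
    θ z ^ 2 * ((a : 𝕜) * dx (fun w => (θ w)⁻¹ * u w) z + (b : 𝕜) * dy (fun w => (θ w)⁻¹ * u w) z) =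
      θ z * ((a : 𝕜) * dx u z + (b : 𝕜) * dy u z) -
        u z * ((a : 𝕜) * dx θ z + (b : 𝕜) * dy θ z) := by
  have hi := hθ.fun_inv h0
  rw [dx_mul hi hu, dy_mul hi hu, dx_inv hθ h0, dy_inv hθ h0]
  field_simp
  ring

/-- The defining equations of `IsMoutard`, read componentwise. -/
theorem moutard_eqs_iff (hD : IsOpen D) {θ : ℝ × ℝ → 𝕜} {N N' : ℝ × ℝ → Fin 3 → 𝕜}
    (hθ : ContDiffOn ℝ 2 θ D) (h0 : ∀ z ∈ D, θ z ≠ 0) (hN : ContDiffOn ℝ 2 N D)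
    (hN' : ContDiffOn ℝ 2 N' D) :
    ((∀ z ∈ D, dx (fun w => θ w • N' w) z =
      θ z ^ 2 • (C z • dx (fun w => (θ w)⁻¹ • N w) z + B z • dy (fun w => (θ w)⁻¹ • N w) z)) ∧
     (∀ z ∈ D, dy (fun w => θ w • N' w) z =
      -(θ z ^ 2 • (A z • dx (fun w => (θ w)⁻¹ • N w) z + C z • dy (fun w => (θ w)⁻¹ • N w) z)))) ↔
    ∀ i, MoutardOn A B C D θ (fun w => N w i) (fun w => N' w i) := by
  have hd : ∀ z ∈ D, DifferentiableAt ℝ (fun w => θ w • N' w) z := fun z hz =>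
    differentiableAt_of_contDiffOn hD (hθ.smul hN') (by norm_num) hz
  have hθd : ∀ z ∈ D, DifferentiableAt ℝ θ z := fun z hz =>
    differentiableAt_of_contDiffOn hD hθ (by norm_num) hz
  have hNd : ∀ z ∈ D, DifferentiableAt ℝ N z := fun z hz =>
    differentiableAt_of_contDiffOn hD hN (by norm_num) hz
  have hq : ∀ z ∈ D, DifferentiableAt ℝ (fun w => (θ w)⁻¹ • N w) z := fun z hz =>
    ((hθd z hz).fun_inv (h0 z hz)).fun_smul (hNd z hz)
  have key (a b : ℝ) (i : Fin 3) (z) (hz : z ∈ D) :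
      (θ z ^ 2 • (a • dx (fun w => (θ w)⁻¹ • N w) z + b • dy (fun w => (θ w)⁻¹ • N w) z)) i =
      θ z * ((a : 𝕜) * dx (fun w => N w i) z + (b : 𝕜) * dy (fun w => N w i) z) -
        N z i * ((a : 𝕜) * dx θ z + (b : 𝕜) * dy θ z) := by
    rw [← moutard_quotient (hθd z hz) (differentiableAt_pi.1 (hNd z hz) i) (h0 z hz) a b]
    rw [Pi.smul_apply, Pi.add_apply, Pi.smul_apply, Pi.smul_apply, dx_apply (hq z hz),
      dy_apply (hq z hz)]
    simp only [Pi.smul_apply, smul_eq_mul, RCLike.real_smul_eq_coe_mul]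
  constructor
  · rintro ⟨hx, hy⟩ i
    constructor <;> intro z hz
    · have h := congrFun (hx z hz) i
      rw [dx_apply (hd z hz), key _ _ _ z hz] at h
      exact h
    · have h := congrFun (hy z hz) i
      rw [dy_apply (hd z hz), Pi.neg_apply, key _ _ _ z hz] at h
      simp only [Pi.smul_apply, smul_eq_mul] at h
      rw [h, starY, starY]
      ring
  · intro h
    constructor <;> intro z hz <;> funext i
    · rw [dx_apply (hd z hz), key _ _ _ z hz]
      exact (h i).eq_x z hz
    · rw [dy_apply (hd z hz), Pi.neg_apply, key _ _ _ z hz]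
      simp only [Pi.smul_apply, smul_eq_mul]
      rw [(h i).eq_y z hz, starY, starY]
      ring

/-- A Moutard transform that preserves `N · N` up to the factor `-ε` yields another solution: by
inverting the transform, its components solve the same linear equation as `θ⁻¹`. -/
theorem isSolution_of_moutardOn (hD : IsOpen D) (hA : ContDiffOn ℝ 1 A D)
    (hB : ContDiffOn ℝ 1 B D) (hC : ContDiffOn ℝ 1 C D) (hABC : ∀ z ∈ D, A z * B z - C z ^ 2 = ε)
    {f θ : ℝ × ℝ → 𝕜} {N N' : ℝ × ℝ → Fin 3 → 𝕜} (hN : IsSolution η A B C D f N)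
    (hθ : ContDiffOn ℝ 2 θ D) (h0 : ∀ z ∈ D, θ z ≠ 0) (hN' : ContDiffOn ℝ 2 N' D)
    (h : ∀ i, MoutardOn A B C D θ (fun w => N w i) (fun w => N' w i))
    (hdot : ∀ z ∈ D, dot η (N' z) (N' z) = -(ε • dot η (N z) (N z))) :
    IsSolution η A B C D (fun z => θ z * selfAdjointOp A B C (fun w => (θ w)⁻¹) z) N' := by
  refine ⟨hN', fun z hz => ?_, fun z hz => ?_⟩
  · funext i
    have hNi := contDiffOn_pi.1 hN.contDiffOn i
    have hNi' := contDiffOn_pi.1 hN' i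
    have hinv := (h i).inverse hABC
      (fun z hz => differentiableAt_of_contDiffOn hD hθ (by norm_num) hz)
      (fun z hz => differentiableAt_of_contDiffOn hD hNi (by norm_num) hz)
      (fun z hz => differentiableAt_of_contDiffOn hD hNi' (by norm_num) hz) h0
    have e : (θ z)⁻¹ * selfAdjointOp A B C (fun w => N' w i) z =
        N' z i * selfAdjointOp A B C (fun w => (θ w)⁻¹) z :=
      hinv.mul_selfAdjointOp hD hA hB hC (hθ.inv h0) hNi' (contDiffOn_const.mul hNi).neg hz
    rw [selfAdjointOp_apply hD hA hB hC hN' hz, Pi.smul_apply, smul_eq_mul]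
    rw [inv_mul_eq_iff_eq_mul₀ (h0 z hz)] at e
    linear_combination e
  · have e : ∀ w ∈ D, dot η (N' w) (N' w) = (-(ε : 𝕜)) * dot η (N w) (N w) := fun w hw => by
      rw [hdot w hw, RCLike.real_smul_eq_coe_mul, neg_mul]
    rw [selfAdjointOp_congr hD e hz,
      selfAdjointOp_const_mul hD hA hB hC _ (contDiffOn_dot hN.contDiffOn hN.contDiffOn) hz,
      hN.norm_eq z hz, mul_zero]

/-! ### Bäcklund transforms and the generator of the superposition -/

theorem ofReal_mul_self (hε : ε = 1 ∨ ε = -1) : (ε : 𝕜) * ε = 1 := by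
  rcases hε with rfl | rfl <;> norm_num

/-- The first-order system for `p` says `dp = ⋆dr` with `r = N · N`. -/
theorem IsPotential.d_eq_star (hε : ε = 1 ∨ ε = -1) (hABC : ∀ z ∈ D, A z * B z - C z ^ 2 = ε)
    {N : ℝ × ℝ → Fin 3 → 𝕜} {p : ℝ × ℝ → 𝕜} (h : IsPotential η ε A B C D N p)
    {z : ℝ × ℝ} (hz : z ∈ D) :
    dx p z = starX B C (fun w => dot η (N w) (N w)) z ∧
      dy p z = starY A C (fun w => dot η (N w) (N w)) z := by
  have hx := h.eq_x z hz
  have hy := h.eq_y z hz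
  have hk : (A z : 𝕜) * B z - (C z : 𝕜) ^ 2 = ε := by
    exact_mod_cast congrArg (fun t : ℝ => (t : 𝕜)) (hABC z hz)
  have he : (ε : 𝕜) * ε = 1 := ofReal_mul_self hε
  simp only [RCLike.real_smul_eq_coe_mul] at hx hy
  constructor
  · rw [starX]
    linear_combination -dx p z * he - (ε : 𝕜) * dx p z * hk
      - (C z : 𝕜) * ε * hx - (B z : 𝕜) * ε * hy +
      (C z * dx (fun w => dot η (N w) (N w)) z + B z * dy (fun w => dot η (N w) (N w)) z) * he
  · rw [starY]
    linear_combination -dy p z * he - (ε : 𝕜) * dy p z * hk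
      + (A z : 𝕜) * ε * hx + (C z : 𝕜) * ε * hy -
      (A z * dx (fun w => dot η (N w) (N w)) z + C z * dy (fun w => dot η (N w) (N w)) z) * he

/-- Differentiating `θ p = N · (θ N')` expresses `N' · dN` through `θ`, `p` and `r = N · N`. -/
theorem theta_mul_dot_d (hD : IsOpen D) {θ p : ℝ × ℝ → 𝕜} {N N' : ℝ × ℝ → Fin 3 → 𝕜}
    (hθ : ContDiffOn ℝ 2 θ D) (hN : ContDiffOn ℝ 2 N D) (hN' : ContDiffOn ℝ 2 N' D)
    (h : ∀ i, MoutardOn A B C D θ (fun w => N w i) (fun w => N' w i))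
    (hp : ∀ z ∈ D, dot η (N z) (N' z) = p z) (hpd : DifferentiableOn ℝ p D)
    {z : ℝ × ℝ} (hz : z ∈ D)
    (hdp : dx p z = starX B C (fun w => dot η (N w) (N w)) z ∧
      dy p z = starY A C (fun w => dot η (N w) (N w)) z) :
    θ z * dot η (dx N z) (N' z) = p z * dx θ z + θ z * dx p z / 2
        + dot η (N z) (N z) * starX B C θ z ∧
    θ z * dot η (dy N z) (N' z) = p z * dy θ z + θ z * dy p z / 2
        + dot η (N z) (N z) * starY A C θ z := by
  have hθd := differentiableAt_of_contDiffOn hD hθ (by norm_num) hz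
  have hNd := differentiableAt_of_contDiffOn hD hN (by norm_num) hz
  have hM := differentiableAt_of_contDiffOn hD (hθ.smul hN') (by norm_num) hz
  change DifferentiableAt ℝ (fun w => θ w • N' w) z at hM
  have hpz := hpd.differentiableAt (hD.mem_nhds hz)
  have e : ∀ w ∈ D, θ w * p w = dot η (N w) (θ w • N' w) := fun w hw => by
    rw [← hp w hw]; simp only [dot, Pi.smul_apply, smul_eq_mul]; ring
  have ex := dx_congr hD e hz
  have ey := dy_congr hD e hz
  have mx (i : Fin 3) := (h i).eq_x z hz
  have my (i : Fin 3) := (h i).eq_y z hz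
  rw [dx_mul hθd hpz, dx_dot hNd hM] at ex
  rw [dy_mul hθd hpz, dy_dot hNd hM] at ey
  obtain ⟨px, py⟩ := hdp
  rw [starX, dx_dot hNd hNd, dy_dot hNd hNd] at px
  rw [starY, dx_dot hNd hNd, dy_dot hNd hNd] at py
  simp only [dot, dx_apply hM, dy_apply hM, Pi.smul_apply, smul_eq_mul, mx, my, starX, starY,
    ← dx_apply hNd, ← dy_apply hNd] at ex ey px py ⊢
  constructor
  · linear_combination -ex + θ z / 2 * px
  · linear_combination -ey + θ z / 2 * py

/-- For two Bäcklund transforms `N₁`, `N₂` of `N` with `W = (N₁ - N₂) · (N₁ - N₂)`, the function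
`θ₁ θ₂ W` is a potential of the form `2 (p₁ - p₂) (θ₁ ⋆dθ₂ - θ₂ ⋆dθ₁)`. Hence, up to a constant
factor, `θ₂ W` is the Moutard transform of the scalar solution `θ₂` generated by `θ₁`. -/
theorem moutardOn_dot_sub (hD : IsOpen D) (hε : ε = 1 ∨ ε = -1)
    (hABC : ∀ z ∈ D, A z * B z - C z ^ 2 = ε)
    {θ₁ θ₂ P : ℝ × ℝ → 𝕜} {k₁ k₂ : 𝕜} {N N₁ N₂ : ℝ × ℝ → Fin 3 → 𝕜}
    (hθ₁ : ContDiffOn ℝ 2 θ₁ D) (hθ₂ : ContDiffOn ℝ 2 θ₂ D) (hN : ContDiffOn ℝ 2 N D)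
    (hN₁ : ContDiffOn ℝ 2 N₁ D) (hN₂ : ContDiffOn ℝ 2 N₂ D)
    (h₁ : ∀ i, MoutardOn A B C D θ₁ (fun w => N w i) (fun w => N₁ w i))
    (h₂ : ∀ i, MoutardOn A B C D θ₂ (fun w => N w i) (fun w => N₂ w i))
    (hP : IsPotential η ε A B C D N P)
    (hp₁ : ∀ z ∈ D, dot η (N z) (N₁ z) = P z + k₁)
    (hp₂ : ∀ z ∈ D, dot η (N z) (N₂ z) = P z + k₂)
    (hd₁ : ∀ z ∈ D, dot η (N₁ z) (N₁ z) = -(ε • dot η (N z) (N z)))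
    (hd₂ : ∀ z ∈ D, dot η (N₂ z) (N₂ z) = -(ε • dot η (N z) (N z))) :
    MoutardOn A B C D θ₁ (fun w => 2 * (k₁ - k₂) * θ₂ w)
      (fun w => θ₂ w * dot η (N₁ w - N₂ w) (N₁ w - N₂ w)) := by
  have e : ∀ w ∈ D, θ₁ w * (θ₂ w * dot η (N₁ w - N₂ w) (N₁ w - N₂ w)) =
      (-2 : 𝕜) * (((ε : 𝕜) * ((θ₁ w * θ₂ w) * dot η (N w) (N w))) +
        dot η (θ₁ w • N₁ w) (θ₂ w • N₂ w)) := fun w hw => by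
    have a₁ := hd₁ w hw
    have a₂ := hd₂ w hw
    rw [RCLike.real_smul_eq_coe_mul] at a₁ a₂
    simp only [dot, Pi.smul_apply, Pi.sub_apply, smul_eq_mul] at a₁ a₂ ⊢
    linear_combination θ₁ w * θ₂ w * (a₁ + a₂)
  have hdP (k : 𝕜) (z) : dx (fun w => P w + k) z = dx P z ∧
      dy (fun w => P w + k) z = dy P z := by
    simp [dx, dy]
  suffices main : ∀ z ∈ D,
      dx (fun w => θ₁ w * (θ₂ w * dot η (N₁ w - N₂ w) (N₁ w - N₂ w))) z =
        2 * (k₁ - k₂) * (θ₁ z * starX B C θ₂ z - θ₂ z * starX B C θ₁ z) ∧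
      dy (fun w => θ₁ w * (θ₂ w * dot η (N₁ w - N₂ w) (N₁ w - N₂ w))) z =
        2 * (k₁ - k₂) * (θ₁ z * starY A C θ₂ z - θ₂ z * starY A C θ₁ z) by
    constructor <;> intro z hz <;>
      have hθ₂d := differentiableAt_of_contDiffOn hD hθ₂ (by norm_num) hz
    · rw [(main z hz).1]
      simp only [starX, dx_const_mul _ hθ₂d, dy_const_mul _ hθ₂d]
      ring
    · rw [(main z hz).2]
      simp only [starY, dx_const_mul _ hθ₂d, dy_const_mul _ hθ₂d]
      ring
  intro z hz
  have hk : (A z : 𝕜) * B z - (C z : 𝕜) ^ 2 = ε := by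
    exact_mod_cast congrArg (fun t : ℝ => (t : 𝕜)) (hABC z hz)
  have hθ₁d := differentiableAt_of_contDiffOn hD hθ₁ (by norm_num) hz
  have hθ₂d := differentiableAt_of_contDiffOn hD hθ₂ (by norm_num) hz
  have hNd := differentiableAt_of_contDiffOn hD hN (by norm_num) hz
  have hM₁ : DifferentiableAt ℝ (fun w => θ₁ w • N₁ w) z :=
    differentiableAt_of_contDiffOn hD (hθ₁.smul hN₁) (by norm_num) hz
  have hM₂ : DifferentiableAt ℝ (fun w => θ₂ w • N₂ w) z :=
    differentiableAt_of_contDiffOn hD (hθ₂.smul hN₂) (by norm_num) hz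
  have hr : DifferentiableAt ℝ (fun w => dot η (N w) (N w)) z :=
    differentiableAt_of_contDiffOn hD (contDiffOn_dot hN hN) (by norm_num) hz
  have hMM : DifferentiableAt ℝ (fun w => dot η (θ₁ w • N₁ w) (θ₂ w • N₂ w)) z :=
    differentiableAt_of_contDiffOn hD (contDiffOn_dot (hθ₁.smul hN₁) (hθ₂.smul hN₂))
      (by norm_num) hz
  have hθr := (hθ₁d.fun_mul hθ₂d).fun_mul hr
  have hdp := hP.d_eq_star hε hABC hz
  have g₁ := theta_mul_dot_d hD hθ₁ hN hN₁ h₁ hp₁ (hP.differentiableOn.add_const k₁) hz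
    (by rw [(hdP k₁ z).1, (hdP k₁ z).2]; exact hdp)
  have g₂ := theta_mul_dot_d hD hθ₂ hN hN₂ h₂ hp₂ (hP.differentiableOn.add_const k₂) hz
    (by rw [(hdP k₂ z).1, (hdP k₂ z).2]; exact hdp)
  rw [(hdP k₁ z).1, (hdP k₁ z).2] at g₁
  rw [(hdP k₂ z).1, (hdP k₂ z).2] at g₂
  obtain ⟨gx₁, gy₁⟩ := g₁
  obtain ⟨gx₂, gy₂⟩ := g₂
  have q₁ := hp₁ z hz
  have q₂ := hp₂ z hz
  obtain ⟨px, py⟩ := hdp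
  have mx₁ (i : Fin 3) := (h₁ i).eq_x z hz
  have mx₂ (i : Fin 3) := (h₂ i).eq_x z hz
  have my₁ (i : Fin 3) := (h₁ i).eq_y z hz
  have my₂ (i : Fin 3) := (h₂ i).eq_y z hz
  rw [dx_congr hD e hz, dx_const_mul _ ((hθr.const_mul _).fun_add hMM),
    dx_add (hθr.const_mul _) hMM, dx_const_mul _ hθr, dx_mul (hθ₁d.fun_mul hθ₂d) hr,
    dx_mul hθ₁d hθ₂d, dx_dot hM₁ hM₂,
    dy_congr hD e hz, dy_const_mul _ ((hθr.const_mul _).fun_add hMM),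
    dy_add (hθr.const_mul _) hMM, dy_const_mul _ hθr, dy_mul (hθ₁d.fun_mul hθ₂d) hr,
    dy_mul hθ₁d hθ₂d, dy_dot hM₁ hM₂]
  -- The gradient of `r = N · N` enters only through `dP = ⋆dr`, so it stays unexpanded.
  rw [starX] at px
  rw [starY] at py
  generalize dx (fun w => dot η (N w) (N w)) z = rx at px py ⊢
  generalize dy (fun w => dot η (N w) (N w)) z = ry at px py ⊢
  simp only [dot, dx_apply hM₁, dx_apply hM₂, dy_apply hM₁, dy_apply hM₂, Pi.smul_apply,
    smul_eq_mul, mx₁, mx₂, my₁, my₂, starX, starY, ← dx_apply hNd, ← dy_apply hNd]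
    at gx₁ gy₁ gx₂ gy₂ q₁ q₂ px py ⊢
  -- The forms `⋆dθ₁`, `⋆dθ₂`, `dP = ⋆dr` occur under one more `⋆`; the multiple of `hk`
  -- accounts for `⋆⋆ = -ε`.
  constructor
  · linear_combination (-2) * (θ₁ z * (C z * gx₂ + B z * gy₂) + θ₂ z * (C z * gx₁ + B z * gy₁)
      - θ₂ z * (C z * dx θ₁ z + B z * dy θ₁ z) * q₂ - θ₁ z * (C z * dx θ₂ z + B z * dy θ₂ z) * q₁
      + θ₁ z * θ₂ z * (C z * px + B z * py)
      - ((N z 0 * N z 0 + η * (N z 1 * N z 1 + N z 2 * N z 2)) *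
          (θ₁ z * dx θ₂ z + θ₂ z * dx θ₁ z) + θ₁ z * θ₂ z * rx) * hk)
  · linear_combination 2 * (θ₁ z * (A z * gx₂ + C z * gy₂) + θ₂ z * (A z * gx₁ + C z * gy₁)
      - θ₂ z * (A z * dx θ₁ z + C z * dy θ₁ z) * q₂ - θ₁ z * (A z * dx θ₂ z + C z * dy θ₂ z) * q₁
      + θ₁ z * θ₂ z * (A z * px + C z * py)
      + ((N z 0 * N z 0 + η * (N z 1 * N z 1 + N z 2 * N z 2)) *
          (θ₁ z * dy θ₂ z + θ₂ z * dy θ₁ z) + θ₁ z * θ₂ z * ry) * hk)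

/-! ### The superposition formula -/

/-- Superposition of Moutard transforms, for one component: if `n₁`, `n₂` are the transforms of `n`
generated by `θ₁`, `θ₂`, and `T` is that of `κ θ₂` generated by `θ₁`, then `T` generates from `n₁`
the transform `v = ε (-n + κ (θ₂ / T) (n₁ - n₂))`. -/
theorem MoutardOn.superposition (hD : IsOpen D) (hABC : ∀ z ∈ D, A z * B z - C z ^ 2 = ε)
    {θ₁ θ₂ T n n₁ n₂ v : ℝ × ℝ → 𝕜} {κ : 𝕜}
    (hθ₁ : ContDiffOn ℝ 2 θ₁ D) (hθ₂ : ContDiffOn ℝ 2 θ₂ D) (hT : ContDiffOn ℝ 2 T D)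
    (hn : ContDiffOn ℝ 2 n D) (hn₁ : ContDiffOn ℝ 2 n₁ D) (hn₂ : ContDiffOn ℝ 2 n₂ D)
    (h0 : ∀ z ∈ D, θ₁ z ≠ 0)
    (h₁ : MoutardOn A B C D θ₁ n n₁) (h₂ : MoutardOn A B C D θ₂ n n₂)
    (h₁₂ : MoutardOn A B C D θ₁ (fun z => κ * θ₂ z) T)
    (hv : ∀ z ∈ D, T z * v z = (ε : 𝕜) * (κ * (θ₂ z * n₁ z - θ₂ z * n₂ z) - T z * n z)) :
    MoutardOn A B C D T n₁ v := by
  have hd {u : ℝ × ℝ → 𝕜} (hu : ContDiffOn ℝ 2 u D) {z} (hz : z ∈ D) : DifferentiableAt ℝ u z :=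
    differentiableAt_of_contDiffOn hD hu (by norm_num) hz
  have hk : ∀ z ∈ D, (A z : 𝕜) * B z - (C z : 𝕜) ^ 2 = ε := fun z hz => by
    exact_mod_cast congrArg (fun t : ℝ => (t : 𝕜)) (hABC z hz)
  -- The Moutard relations give the differentials of the products `θ₁ n₁` and `θ₁ T`, so the claim
  -- is first multiplied by `θ₁`.
  constructor <;> intro z hz <;> refine mul_left_cancel₀ (h0 z hz) ?_ <;>
    have dn := hd hn hz <;> have dn₁ := hd hn₁ hz <;> have dn₂ := hd hn₂ hz <;>
    have dθ₁ := hd hθ₁ hz <;> have dθ₂ := hd hθ₂ hz <;> have dT := hd hT hz <;>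
    have d₁ := dθ₂.fun_mul dn₁ <;> have d₂ := dθ₂.fun_mul dn₂ <;>
    have k := hk z hz <;>
    have tx := h₁₂.eq_x z hz <;> have ty := h₁₂.eq_y z hz <;>
    have x₁ := h₁.eq_x z hz <;> have y₁ := h₁.eq_y z hz <;>
    rw [dx_mul dθ₁ dT, starX, dx_const_mul _ dθ₂, dy_const_mul _ dθ₂] at tx <;>
    rw [dy_mul dθ₁ dT, starY, dx_const_mul _ dθ₂, dy_const_mul _ dθ₂] at ty <;>
    rw [dx_mul dθ₁ dn₁] at x₁ <;> rw [dy_mul dθ₁ dn₁] at y₁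
  · have x₂ := h₂.eq_x z hz
    rw [dx_congr hD hv hz, dx_const_mul _ (((d₁.fun_sub d₂).const_mul _).fun_sub (dT.fun_mul dn)),
      dx_sub ((d₁.fun_sub d₂).const_mul _) (dT.fun_mul dn), dx_const_mul _ (d₁.fun_sub d₂),
      dx_sub d₁ d₂, dx_mul dθ₂ dn₁, dx_mul dT dn]
    simp only [starX, starY] at tx ty x₁ y₁ x₂ ⊢
    linear_combination (ε : 𝕜) * (κ * θ₂ z * x₁ - κ * θ₁ z * x₂ - n z * tx)
      - T z * (C z * x₁ + B z * y₁) + n₁ z * (C z * tx + B z * ty)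
      + (T z * (θ₁ z * dx n z - n z * dx θ₁ z)
        - n₁ z * κ * (θ₁ z * dx θ₂ z - θ₂ z * dx θ₁ z)) * k
  · have y₂ := h₂.eq_y z hz
    rw [dy_congr hD hv hz, dy_const_mul _ (((d₁.fun_sub d₂).const_mul _).fun_sub (dT.fun_mul dn)),
      dy_sub ((d₁.fun_sub d₂).const_mul _) (dT.fun_mul dn), dy_const_mul _ (d₁.fun_sub d₂),
      dy_sub d₁ d₂, dy_mul dθ₂ dn₁, dy_mul dT dn]
    simp only [starX, starY] at tx ty x₁ y₁ y₂ ⊢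
    linear_combination (ε : 𝕜) * (κ * θ₂ z * y₁ - κ * θ₁ z * y₂ - n z * ty)
      + T z * (A z * x₁ + C z * y₁) - n₁ z * (A z * tx + C z * ty)
      + (T z * (θ₁ z * dy n z - n z * dy θ₁ z)
        - n₁ z * κ * (θ₁ z * dy θ₂ z - θ₂ z * dy θ₁ z)) * k

/-- The permutability formula: the fourth vertex of the quadrilateral with vertices `N`, `N₁`,
`N₂`. Up to the sign `-ε` it is the reflection of `N` in the plane orthogonal to `N₁ - N₂`. -/
def superpose (η ε : ℝ) (N N₁ N₂ : ℝ × ℝ → Fin 3 → 𝕜) (z : ℝ × ℝ) : Fin 3 → 𝕜 :=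
  ε • (-N z + (2 * dot η (N₁ z - N₂ z) (N z) /
    dot η (N₁ z - N₂ z) (N₁ z - N₂ z)) • (N₁ z - N₂ z))

theorem superpose_apply (N N₁ N₂ : ℝ × ℝ → Fin 3 → 𝕜) (z : ℝ × ℝ) (i : Fin 3) :
    superpose η ε N N₁ N₂ z i = (ε : 𝕜) * (-N z i + 2 * dot η (N₁ z - N₂ z) (N z) /
      dot η (N₁ z - N₂ z) (N₁ z - N₂ z) * (N₁ z i - N₂ z i)) := by
  simp only [superpose, Pi.smul_apply, Pi.add_apply, Pi.neg_apply, Pi.sub_apply, smul_eq_mul,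
    RCLike.real_smul_eq_coe_mul]

theorem superpose_comm (N N₁ N₂ : ℝ × ℝ → Fin 3 → 𝕜) (z : ℝ × ℝ) :
    superpose η ε N N₁ N₂ z = superpose η ε N N₂ N₁ z := by
  funext i
  have e₁ : dot η (N₂ z - N₁ z) (N z) = -dot η (N₁ z - N₂ z) (N z) := by
    simp only [dot, Pi.sub_apply]; ring
  have e₂ : dot η (N₂ z - N₁ z) (N₂ z - N₁ z) = dot η (N₁ z - N₂ z) (N₁ z - N₂ z) := by
    simp only [dot, Pi.sub_apply]; ring
  rw [superpose_apply, superpose_apply, e₁, e₂]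
  ring

theorem contDiffOn_superpose {N N₁ N₂ : ℝ × ℝ → Fin 3 → 𝕜} (hN : ContDiffOn ℝ 2 N D)
    (hN₁ : ContDiffOn ℝ 2 N₁ D) (hN₂ : ContDiffOn ℝ 2 N₂ D)
    (hne : ∀ z ∈ D, dot η (N₁ z - N₂ z) (N₁ z - N₂ z) ≠ 0) :
    ContDiffOn ℝ 2 (superpose η ε N N₁ N₂) D := by
  have h := hN₁.sub hN₂
  have hc : ContDiffOn ℝ 2 (fun z => 2 * dot η (N₁ z - N₂ z) (N z) /
      dot η (N₁ z - N₂ z) (N₁ z - N₂ z)) D := by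
    simp only [div_eq_mul_inv]
    exact (contDiffOn_const.mul (contDiffOn_dot h hN)).mul ((contDiffOn_dot h h).inv hne)
  exact (hN.neg.add (hc.smul h)).const_smul ε

/-- The superposition with its coefficient known only through the equation that defines it, which
keeps the identities below polynomial. -/
theorem exists_superpose_eq {N N₁ N₂ : ℝ × ℝ → Fin 3 → 𝕜} {z : ℝ × ℝ}
    (hne : dot η (N₁ z - N₂ z) (N₁ z - N₂ z) ≠ 0) :
    ∃ c : 𝕜, c * dot η (N₁ z - N₂ z) (N₁ z - N₂ z) = 2 * dot η (N₁ z - N₂ z) (N z) ∧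
      ∀ i, superpose η ε N N₁ N₂ z i = (ε : 𝕜) * (-N z i + c * (N₁ z i - N₂ z i)) :=
  ⟨_, div_mul_cancel₀ _ hne, fun i => superpose_apply N N₁ N₂ z i⟩

/-- The reflection preserves the length of `N`. -/
theorem dot_superpose_self (hε : ε = 1 ∨ ε = -1) {N N₁ N₂ : ℝ × ℝ → Fin 3 → 𝕜} {z : ℝ × ℝ}
    (hne : dot η (N₁ z - N₂ z) (N₁ z - N₂ z) ≠ 0) :
    dot η (superpose η ε N N₁ N₂ z) (superpose η ε N N₁ N₂ z) = dot η (N z) (N z) := by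
  have he : (ε : 𝕜) * ε = 1 := ofReal_mul_self hε
  obtain ⟨c, hc, hs⟩ := exists_superpose_eq (ε := ε) (N := N) hne
  simp only [dot, Pi.sub_apply] at hc
  simp only [dot, hs]
  linear_combination (ε : 𝕜) ^ 2 * c * hc +
    (N z 0 * N z 0 + (η : 𝕜) * (N z 1 * N z 1 + N z 2 * N z 2)) * he

/-- The isosceles condition `N₁ · N₁ = N₂ · N₂` makes `N₁ · (N₁ - N₂)` equal to half of
`(N₁ - N₂) · (N₁ - N₂)`, so that the superposition satisfies `N₁ · N₁₂ = -ε N · N₂`. -/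
theorem dot_superpose {N N₁ N₂ : ℝ × ℝ → Fin 3 → 𝕜} {z : ℝ × ℝ}
    (hne : dot η (N₁ z - N₂ z) (N₁ z - N₂ z) ≠ 0)
    (h : dot η (N₁ z) (N₁ z) = dot η (N₂ z) (N₂ z)) :
    dot η (N₁ z) (superpose η ε N N₁ N₂ z) = -((ε : 𝕜) * dot η (N z) (N₂ z)) := by
  obtain ⟨c, hc, hs⟩ := exists_superpose_eq (ε := ε) (N := N) hne
  simp only [dot, Pi.sub_apply] at hc h
  simp only [dot, hs]
  linear_combination (ε : 𝕜) * c / 2 * h + (ε : 𝕜) / 2 * hc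

/-- One half of the permutability theorem: the superposition is a Bäcklund transform of `N₁`.
For `k₁ ≠ k₂` it is generated by `θ₂ W` with `W = (N₁ - N₂) · (N₁ - N₂)`; for `k₁ = k₂` it is
`-ε N`, obtained from `N₁` by the inverse transform, which is generated by `θ₁⁻¹`. -/
theorem isBacklund_superpose (hε : ε = 1 ∨ ε = -1) (hD : IsOpen D)
    (hA : ContDiffOn ℝ 1 A D) (hB : ContDiffOn ℝ 1 B D) (hC : ContDiffOn ℝ 1 C D)
    (hABC : ∀ z ∈ D, A z * B z - C z ^ 2 = ε) {N N₁ N₂ : ℝ × ℝ → Fin 3 → 𝕜}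
    {P : ℝ × ℝ → 𝕜} (hP : IsPotential η ε A B C D N P) {k₁ k₂ : 𝕜}
    (h₁ : IsBacklund η ε A B C D N (fun z => P z + k₁) N₁)
    (h₂ : IsBacklund η ε A B C D N (fun z => P z + k₂) N₂)
    (hne : ∀ z ∈ D, dot η (N₁ z - N₂ z) (N₁ z - N₂ z) ≠ 0) :
    IsBacklund η ε A B C D N₁ (fun z => -(ε • (P z + k₂))) (superpose η ε N N₁ N₂) ∧
      ∃ f : ℝ × ℝ → 𝕜, IsSolution η A B C D f (superpose η ε N N₁ N₂) := by
  obtain ⟨-, ⟨f₁, θ₁, hN, m₁⟩, hp₁, hd₁⟩ := h₁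
  obtain ⟨-, ⟨f₂, θ₂, -, m₂⟩, hp₂, hd₂⟩ := h₂
  have hNc := hN.contDiffOn
  have hθ₁ := m₁.theta_contDiffOn
  have hθ₂ := m₂.theta_contDiffOn
  have h0₁ := m₁.theta_ne_zero
  have h0₂ := m₂.theta_ne_zero
  have hN₁ := m₁.contDiffOn
  have hN₂ := m₂.contDiffOn
  have M₁ := (moutard_eqs_iff hD hθ₁ h0₁ hNc hN₁).1 ⟨m₁.eq_x, m₁.eq_y⟩
  have M₂ := (moutard_eqs_iff hD hθ₂ h0₂ hNc hN₂).1 ⟨m₂.eq_x, m₂.eq_y⟩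
  have hV := contDiffOn_superpose (ε := ε) hNc hN₁ hN₂ hne
  have hsol₁ := isSolution_of_moutardOn hD hA hB hC hABC hN hθ₁ h0₁ hN₁ M₁ hd₁
  have he : (ε : 𝕜) * ε = 1 := ofReal_mul_self hε
  have hd {F : Type _} [NormedAddCommGroup F] [NormedSpace ℝ F] {u : ℝ × ℝ → F}
      (hu : ContDiffOn ℝ 2 u D) (z) (hz : z ∈ D) : DifferentiableAt ℝ u z :=
    differentiableAt_of_contDiffOn hD hu (by norm_num) hz
  have hq : ∀ z ∈ D, dot η (N₁ z - N₂ z) (N z) = k₁ - k₂ := fun z hz => by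
    have a := hp₁ z hz
    have b := hp₂ z hz
    simp only [dot, Pi.sub_apply] at a b ⊢
    linear_combination a - b
  have gen : ∃ θ : ℝ × ℝ → 𝕜, ContDiffOn ℝ 2 θ D ∧ (∀ z ∈ D, θ z ≠ 0) ∧
      (∀ z ∈ D, selfAdjointOp A B C θ z =
        θ₁ z * selfAdjointOp A B C (fun w => (θ₁ w)⁻¹) z * θ z) ∧
      ∀ i, MoutardOn A B C D θ (fun w => N₁ w i) (fun w => superpose η ε N N₁ N₂ w i) := by
    by_cases hk : k₁ = k₂
    · -- The coefficient `2 (k₁ - k₂) / W` vanishes, leaving `-ε N`.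
      refine ⟨fun w => (θ₁ w)⁻¹, hθ₁.inv h0₁, fun z hz => inv_ne_zero (h0₁ z hz),
        fun z hz => ?_, fun i => ?_⟩
      · have := h0₁ z hz
        rw [mul_right_comm, mul_inv_cancel₀ this, one_mul]
      · have inv := (M₁ i).inverse hABC (hd hθ₁) (hd (contDiffOn_pi.1 hNc i))
          (hd (contDiffOn_pi.1 hN₁ i)) h0₁
        have e : ∀ z ∈ D, (θ₁ z)⁻¹ * superpose η ε N N₁ N₂ z i =
            (θ₁ z)⁻¹ * -((ε : 𝕜) * N z i) := fun z hz => by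
          rw [superpose_apply, hq z hz, hk, sub_self]
          ring
        exact ⟨fun z hz => (dx_congr hD e hz).trans (inv.eq_x z hz),
          fun z hz => (dy_congr hD e hz).trans (inv.eq_y z hz)⟩
    · have hκ : 2 * (k₁ - k₂) ≠ 0 := mul_ne_zero two_ne_zero (sub_ne_zero.2 hk)
      have hT := hθ₂.mul (contDiffOn_dot (η := η) (hN₁.sub hN₂) (hN₁.sub hN₂))
      have M₁₂ := moutardOn_dot_sub hD hε hABC hθ₁ hθ₂ hNc hN₁ hN₂ M₁ M₂ hP hp₁ hp₂ hd₁ hd₂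
      have hu : ContDiffOn ℝ 2 (fun w => 2 * (k₁ - k₂) * θ₂ w) D := contDiffOn_const.mul hθ₂
      refine ⟨_, hT, fun z hz => mul_ne_zero (h0₂ z hz) (hne z hz), fun z hz => ?_, fun i => ?_⟩
      · -- `θ₂ W` is a Moutard transform generated by `θ₁`, so it solves the equation of `θ₁⁻¹`.
        have inv := M₁₂.inverse hABC (hd hθ₁) (hd hu) (hd hT) h0₁
        have e : (θ₁ z)⁻¹ * selfAdjointOp A B C
              (fun w => θ₂ w * dot η (N₁ w - N₂ w) (N₁ w - N₂ w)) z =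
            θ₂ z * dot η (N₁ z - N₂ z) (N₁ z - N₂ z) *
              selfAdjointOp A B C (fun w => (θ₁ w)⁻¹) z :=
          inv.mul_selfAdjointOp hD hA hB hC (hθ₁.inv h0₁) hT (contDiffOn_const.mul hu).neg hz
        rw [inv_mul_eq_iff_eq_mul₀ (h0₁ z hz)] at e
        refine e.trans ?_
        ring
      · refine MoutardOn.superposition hD hABC hθ₁ hθ₂ hT (contDiffOn_pi.1 hNc i)
          (contDiffOn_pi.1 hN₁ i) (contDiffOn_pi.1 hN₂ i) h0₁ (M₁ i) (M₂ i) M₁₂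
          (fun z hz => ?_)
        have := hne z hz
        rw [superpose_apply, hq z hz]
        field_simp
        ring
  obtain ⟨θ, hθ, h0, hLθ, M⟩ := gen
  obtain ⟨ex, ey⟩ := (moutard_eqs_iff hD hθ h0 hN₁ hV).2 M
  have hdot : ∀ z ∈ D, dot η (superpose η ε N N₁ N₂ z) (superpose η ε N N₁ N₂ z) =
      -(ε • dot η (N₁ z) (N₁ z)) := fun z hz => by
    rw [dot_superpose_self hε (hne z hz), hd₁ z hz]
    simp only [RCLike.real_smul_eq_coe_mul]
    linear_combination (-dot η (N z) (N z)) * he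
  refine ⟨⟨?_, ⟨_, θ, hsol₁, hθ, h0, hLθ, hV, ex, ey⟩, fun z hz => ?_, hdot⟩,
    _, isSolution_of_moutardOn hD hA hB hC hABC hsol₁ hθ h0 hV M hdot⟩
  · have hr : ∀ z ∈ D, DifferentiableAt ℝ (fun w => dot η (N w) (N w)) z :=
      hd (contDiffOn_dot hNc hNc)
    have hPd : ∀ z ∈ D, DifferentiableAt ℝ P z := fun z hz =>
      hP.differentiableOn.differentiableAt (hD.mem_nhds hz)
    have e₁ : ∀ w ∈ D, dot η (N₁ w) (N₁ w) = (-(ε : 𝕜)) * dot η (N w) (N w) := fun w hw => by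
      rw [hd₁ w hw, RCLike.real_smul_eq_coe_mul, neg_mul]
    have e₂ : (fun z => -(ε • (P z + k₂))) = fun z => (-(ε : 𝕜)) * (P z + k₂) := by
      funext z; rw [RCLike.real_smul_eq_coe_mul, neg_mul]
    have ePx (z) : dx (fun w => P w + k₂) z = dx P z := by simp [dx]
    have ePy (z) : dy (fun w => P w + k₂) z = dy P z := by simp [dy]
    rw [e₂]
    refine ⟨(hP.differentiableOn.add_const k₂).const_mul _, fun z hz => ?_, fun z hz => ?_⟩
    · have h := hP.eq_x z hz
      rw [dx_congr hD e₁ hz, dx_const_mul _ (hr z hz), dx_const_mul _ ((hPd z hz).add_const k₂),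
        dy_const_mul _ ((hPd z hz).add_const k₂), ePx, ePy]
      simp only [RCLike.real_smul_eq_coe_mul] at h ⊢
      linear_combination (-(ε : 𝕜)) * h
    · have h := hP.eq_y z hz
      rw [dy_congr hD e₁ hz, dy_const_mul _ (hr z hz), dx_const_mul _ ((hPd z hz).add_const k₂),
        dy_const_mul _ ((hPd z hz).add_const k₂), ePx, ePy]
      simp only [RCLike.real_smul_eq_coe_mul] at h ⊢
      linear_combination (-(ε : 𝕜)) * h
  · have hh : dot η (N₁ z) (N₁ z) = dot η (N₂ z) (N₂ z) := (hd₁ z hz).trans (hd₂ z hz).symm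
    rw [dot_superpose (hne z hz) hh, hp₂ z hz]
    simp only [RCLike.real_smul_eq_coe_mul]

end Bianchi

end

theorem mainTheorem4 {𝕜 : Type*} [RCLike 𝕜]
    (η : ℝ) (hη : η = 1 ∨ η = -1) (ε : ℝ) (hε : ε = 1 ∨ ε = -1)
    (D : Set (ℝ × ℝ)) (hD : IsOpen D)
    (A B C : ℝ × ℝ → ℝ)
    (hA : ContDiffOn ℝ 1 A D) (hB : ContDiffOn ℝ 1 B D) (hC : ContDiffOn ℝ 1 C D)
    (hABC : ∀ z ∈ D, A z * B z - C z ^ 2 = ε)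
    (f : ℝ × ℝ → 𝕜) (N N₁ N₂ : ℝ × ℝ → Fin 3 → 𝕜)
    (hN : Bianchi.IsSolution η A B C D f N)
    (hr : ∀ z ∈ D, Bianchi.dot η (N z) (N z) ≠ 0)
    (P : ℝ × ℝ → 𝕜) (hP : Bianchi.IsPotential η ε A B C D N P)
    (k₁ k₂ : 𝕜)
    (h₁ : Bianchi.IsBacklund η ε A B C D N (fun z => P z + k₁) N₁)
    (h₂ : Bianchi.IsBacklund η ε A B C D N (fun z => P z + k₂) N₂)
    (hne : ∀ z ∈ D, Bianchi.dot η (N₁ z - N₂ z) (N₁ z - N₂ z) ≠ 0) :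
    ∃ N₁₂ N₂₁ : ℝ × ℝ → Fin 3 → 𝕜,
      Bianchi.IsBacklund η ε A B C D N₁ (fun z => -(ε • (P z + k₂))) N₁₂ ∧
      Bianchi.IsBacklund η ε A B C D N₂ (fun z => -(ε • (P z + k₁))) N₂₁ ∧
      (∃ f₁₂ : ℝ × ℝ → 𝕜, Bianchi.IsSolution η A B C D f₁₂ N₁₂) ∧
      (∃ f₂₁ : ℝ × ℝ → 𝕜, Bianchi.IsSolution η A B C D f₂₁ N₂₁) ∧
      (∀ z ∈ D, N₁₂ z = N₂₁ z) ∧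
      (∀ z ∈ D, N₁₂ z = ε • (-N z +
        (2 * Bianchi.dot η (N₁ z - N₂ z) (N z) /
            Bianchi.dot η (N₁ z - N₂ z) (N₁ z - N₂ z)) • (N₁ z - N₂ z))) := by
  obtain ⟨b₁₂, s₁₂⟩ := Bianchi.isBacklund_superpose hε hD hA hB hC hABC hP h₁ h₂ hne
  have hne' : ∀ z ∈ D, Bianchi.dot η (N₂ z - N₁ z) (N₂ z - N₁ z) ≠ 0 := fun z hz h =>
    hne z hz (by rw [← h]; simp only [Bianchi.dot, Pi.sub_apply]; ring)
  obtain ⟨b₂₁, s₂₁⟩ := Bianchi.isBacklund_superpose hε hD hA hB hC hABC hP h₂ h₁ hne'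
  exact ⟨_, _, b₁₂, b₂₁, s₁₂, s₂₁, fun z _ => Bianchi.superpose_comm N N₁ N₂ z, fun z _ => rfl⟩
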